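/- An orientation of a simple graph $Y$ is a digraph $\vec{Y}$ on the same vertex set obtained by giving each edge of $Y$ exactly one of its two directions. A change of direction in a digraph is an unordered pair of distinct directed edges incident to a common vertex that are both directed towards, or both directed away from, that vertex. **Lemma.** For all integers $g \ge 3$ and $n \ge 2$ there is a finite simple graph $Y_n$ with an orientation $\vec{Y_n}$ such that $\chi(Y_n) = n$ and, for every cycle in $Y_n$, the corresponding oriented cycle in $\vec{Y_n}$ (formed by the directed edges of $\vec{Y_n}$ lying over the edges of the cycle) contains at least $g$ changes of direction. -/

import Mathlib

namespace OrientedGraph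

/-- `D` is an orientation of the simple graph `G`: the edges of `G` are exactly the pairs joined
by an arc of `D`, and no pair carries arcs in both directions (in particular, `D` has no loops). -/
structure IsOrientation {V : Type*} (D : Digraph V) (G : SimpleGraph V) : Prop where
  adj_iff : ∀ u v : V, G.Adj u v ↔ D.Adj u v ∨ D.Adj v u
  asymm : ∀ u v : V, D.Adj u v → ¬ D.Adj v u

/-- The changes of direction in a digraph: unordered pairs of distinct arcs, incident to a common
vertex `v`, that are both directed towards `v` or both directed away from `v`.
The arc from `a` to `b` is written `(a, b)`. -/
def changesOfDirection {V : Type*} (D : Digraph V) : Set (Sym2 (V × V)) :=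
  {p | ∃ u v w : V, u ≠ w ∧
    ((D.Adj u v ∧ D.Adj w v ∧ p = s((u, v), (w, v))) ∨
     (D.Adj v u ∧ D.Adj v w ∧ p = s((v, u), (v, w))))}

/-- The digraph formed by the arcs of `D` that lie over the edges of the walk `c`. When `D` is an
orientation of `G` and `c` is a cycle of `G`, this is the corresponding oriented cycle in `D`. -/
def orientedWalk {V : Type*} {G : SimpleGraph V} (D : Digraph V) {u v : V} (c : G.Walk u v) :
    Digraph V where
  Adj a b := D.Adj a b ∧ s(a, b) ∈ c.edges

end OrientedGraph

namespace OrientedGraph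

open Function

/-! Tutte's construction raises the chromatic number by one. Given a digraph on `V` of chromatic
number n + 1, take a sparse hypergraph with edges of size |V| in which every (n + 1)-colouring has a
monochromatic edge, and match a fresh copy of the digraph with each hyperedge, all matching arcs
pointing to the hypergraph. A cycle either stays in one copy or passes through at least g hypergraph
vertices, all of them sinks and so changes of direction (`manyChanges_tutteArc`).

The hypergraphs come from partite amalgamation (`exists_sparse_hasMonoEdge`): induction on the
girth, gluing copies along one part at a time. Both constructions rest on
`constant_label_or_many_changes`. Cycles are modelled by finite sets with a successor map, which
pull back along injections. -/

/-! ### Sparse hypergraphs and label changes. -/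

/-- A hypergraph with edges `φ e`, labelled by `W`, is `g`-sparse if every nonempty finite vertex
set with a successor map, along which one moves inside edges and changes the edge at each step,
has at least `g` elements. In particular all Berge cycles have length at least `g`. -/
def Sparse {X E W : Type} (g : ℕ) (φ : E → W → X) : Prop :=
  ∀ (I : Finset X) (s : X → X) (f : X → E), I.Nonempty →
    (∀ x ∈ I, s x ∈ I ∧ x ∈ Set.range (φ (f x)) ∧ s x ∈ Set.range (φ (f x)) ∧ f (s x) ≠ f x) →
    g ≤ I.card

/-- Every colouring of the vertices with colours in `K` admits a monochromatic edge. -/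
def HasMonoEdge {X E W : Type} (K : Type) (φ : E → W → X) : Prop :=
  ∀ col : X → K, ∃ e, ∀ w w', col (φ e w) = col (φ e w')

theorem iterate_mem {X : Type} {I : Finset X} {s : X → X} (hs : ∀ x ∈ I, s x ∈ I) {y : X}
    (hy : y ∈ I) (k : ℕ) : s^[k] y ∈ I := by
  induction k with
  | zero => exact hy
  | succ k ih => rw [iterate_succ_apply']; exact hs _ ih

/-- A closed finite set whose steps are labelled by the edges of a sparse hypergraph, such that the
label can change only at vertices of the hypergraph, either contains an orbit with constant label
or has many label changes. -/
theorem constant_label_or_many_changes {X' XH EH W : Type} {g : ℕ} {ψ : EH → W → XH}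
    (hψ : Sparse g ψ) (j : XH → X') (hj : Injective j) (M : EH → Set X')
    (hM : ∀ h h' x, h ≠ h' → x ∈ M h → x ∈ M h' → x ∈ Set.range j)
    (hMj : ∀ h a, j a ∈ M h → a ∈ Set.range (ψ h))
    (I : Finset X') (hI : I.Nonempty) (s : X' → X') (κ : X' → EH)
    (hs : ∀ x ∈ I, s x ∈ I) (hκ : ∀ x ∈ I, x ∈ M (κ x) ∧ s x ∈ M (κ x)) :
    (∃ y ∈ I, ∀ k, κ (s^[k] y) = κ y) ∨
      ∃ C : Finset X', g ≤ C.card ∧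
        ∀ y ∈ C, y ∈ I ∧ y ∈ Set.range j ∧ ∃ z ∈ I, s z = y ∧ κ z ≠ κ y := by
  classical
  by_cases hconst : ∃ y ∈ I, ∀ k, κ (s^[k] y) = κ y
  · exact Or.inl hconst
  right
  push Not at hconst
  -- Follow the orbit of `y` to the last vertex before its label first changes.
  have hnext : ∀ y ∈ I, ∃ z ∈ I, κ z = κ y ∧ κ (s z) ≠ κ y := by
    intro y hy
    have hex := hconst y hy
    have hspec := Nat.find_spec hex
    cases hm : Nat.find hex with
    | zero => rw [hm] at hspec; exact absurd rfl hspec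
    | succ m =>
      rw [hm, iterate_succ_apply'] at hspec
      refine ⟨s^[m] y, iterate_mem hs hy m, ?_, hspec⟩
      by_contra hne
      have := Nat.find_min' hex hne
      omega
  choose! t htI htκ htne using hnext
  let C := (I.filter fun x => κ (s x) ≠ κ x).image s
  have hC : ∀ y ∈ C, y ∈ I ∧ y ∈ Set.range j ∧ ∃ z ∈ I, s z = y ∧ κ z ≠ κ y := by
    intro y hy
    obtain ⟨z, hz, rfl⟩ := Finset.mem_image.1 hy
    obtain ⟨hzI, hzκ⟩ := Finset.mem_filter.1 hz
    exact ⟨hs z hzI, hM _ _ _ hzκ (hκ _ (hs z hzI)).1 (hκ z hzI).2, z, hzI, rfl, hzκ.symm⟩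
  have htC : ∀ y ∈ I, s (t y) ∈ C := fun y hy =>
    Finset.mem_image_of_mem s
      (Finset.mem_filter.2 ⟨htI y hy, by rw [htκ y hy]; exact htne y hy⟩)
  refine ⟨C, ?_, hC⟩
  -- The first-return map to `C` moves inside the hyperedge `κ y` and then changes hyperedge, so
  -- sparsity of `ψ` bounds `C`.
  have hret : ∀ a, j a ∈ C → ∃ b, j b = s (t (j a)) := fun a ha =>
    (hC _ (htC _ (hC _ ha).1)).2.1
  obtain ⟨y₀, hy₀⟩ := hI
  obtain ⟨a₀, ha₀⟩ := (hC _ (htC _ hy₀)).2.1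
  have : Nonempty XH := ⟨a₀⟩
  choose! r hr using hret
  have key := hψ (C.preimage j hj.injOn) r (fun a => κ (j a))
    ⟨a₀, by rw [Finset.mem_preimage, ha₀]; exact htC _ hy₀⟩ (by
      intro a ha
      rw [Finset.mem_preimage] at ha
      have haI := (hC _ ha).1
      refine ⟨?_, hMj _ _ (hκ _ haI).1, hMj _ _ ?_, ?_⟩
      · rw [Finset.mem_preimage, hr a ha]; exact htC _ haI
      · rw [hr a ha, ← htκ _ haI]; exact (hκ _ (htI _ haI)).2
      · rw [hr a ha]; exact htne _ haI)
  refine key.trans ?_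
  rw [← Finset.card_image_of_injective _ hj]
  refine Finset.card_le_card fun y hy => ?_
  obtain ⟨a, ha, rfl⟩ := Finset.mem_image.1 hy
  exact Finset.mem_preimage.1 ha

/-! ### Amalgamation of partite hypergraphs. -/

section Amalgam

variable {A X E W XH EH : Type} (π : X → A) (i : A) (ψ : EH → X → XH)

open Classical in
/-- The copy of `X` indexed by `h` in the amalgam along the part `i` of `X`. -/
noncomputable def amalgamEmb (h : EH) (x : X) : XH ⊕ EH × X :=
  if π x = i then Sum.inl (ψ h x) else Sum.inr (h, x)

/-- The partition of the amalgam into parts. -/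
def amalgamPart : XH ⊕ EH × X → A
  | Sum.inl _ => i
  | Sum.inr p => π p.2

/-- The edges of the amalgam. -/
noncomputable def amalgamEdge (φ : E → W → X) (p : EH × E) (w : W) : XH ⊕ EH × X :=
  amalgamEmb π i ψ p.1 (φ p.2 w)

theorem amalgamPart_emb (h : EH) (x : X) :
    amalgamPart (XH := XH) π i (amalgamEmb π i ψ h x) = π x := by
  unfold amalgamEmb
  split_ifs with hx
  · exact hx.symm
  · rfl

variable {π i ψ}

theorem amalgamEmb_injective (hψ : ∀ h, Injective (ψ h)) (h : EH) :
    Injective (amalgamEmb π i ψ h) := by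
  intro x y hxy
  unfold amalgamEmb at hxy
  split_ifs at hxy
  · exact hψ h (Sum.inl.inj hxy)
  · exact (Prod.mk.inj (Sum.inr.inj hxy)).2

theorem mem_range_inl_of_amalgamEmb_eq {h h' : EH} (hne : h ≠ h') {x x' : X}
    (hx : amalgamEmb π i ψ h x = amalgamEmb π i ψ h' x') :
    amalgamEmb π i ψ h x ∈ Set.range Sum.inl := by
  by_cases h1 : π x = i
  · rw [amalgamEmb, if_pos h1]
    exact ⟨_, rfl⟩
  · rw [amalgamEmb, if_neg h1, amalgamEmb] at hx
    split_ifs at hx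
    exact absurd (Prod.mk.inj (Sum.inr.inj hx)).1 hne

theorem mem_range_of_amalgamEmb_eq_inl {h : EH} {x : X} {a : XH}
    (hx : amalgamEmb π i ψ h x = Sum.inl a) : a ∈ Set.range (ψ h) := by
  unfold amalgamEmb at hx
  split_ifs at hx
  exact ⟨x, Sum.inl.inj hx⟩

/-- Amalgamating a partite sparse hypergraph along a sparse one increases sparsity. -/
theorem sparse_amalgamEdge {g : ℕ} {φ : E → W → X} (hφ : ∀ e, Injective (π ∘ φ e))
    (hφs : Sparse (g + 1) φ) (hψi : ∀ h, Injective (ψ h)) (hψ : Sparse g ψ) :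
    Sparse (g + 1) (amalgamEdge π i ψ φ) := by
  classical
  intro I s f hI hf
  have hs : ∀ x ∈ I, s x ∈ I := fun x hx => (hf x hx).1
  rcases constant_label_or_many_changes hψ Sum.inl Sum.inl_injective
      (fun h => Set.range (amalgamEmb π i ψ h))
      (by
        rintro h h' x hne ⟨u, rfl⟩ ⟨v, hv⟩
        exact mem_range_inl_of_amalgamEmb_eq hne hv.symm)
      (by
        rintro h a ⟨u, hu⟩
        exact mem_range_of_amalgamEmb_eq_inl hu)
      I hI s (fun x => (f x).1) hs
      (by
        intro x hx
        obtain ⟨-, ⟨u, hu⟩, ⟨v, hv⟩, -⟩ := hf x hx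
        exact ⟨⟨_, hu⟩, ⟨_, hv⟩⟩) with ⟨y, hy, hconst⟩ | ⟨C, hCg, hC⟩
  -- The orbit of `y` stays in a single copy; pull it back and use sparsity of `φ`.
  · set h := (f y).1 with hh
    have hinj := amalgamEmb_injective (π := π) (i := i) hψi h
    let J := I.filter fun x => ∃ k, s^[k] y = x
    have hJf : ∀ x ∈ J, (f x).1 = h := by
      intro x hx
      obtain ⟨k, rfl⟩ := (Finset.mem_filter.1 hx).2
      exact hconst k
    have hJs : ∀ x ∈ J, s x ∈ J := by
      intro x hx
      obtain ⟨hxI, k, rfl⟩ := Finset.mem_filter.1 hx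
      exact Finset.mem_filter.2 ⟨hs _ hxI, k + 1, iterate_succ_apply' _ _ _⟩
    have hedge : ∀ x ∈ J, amalgamEdge π i ψ φ (f x) = amalgamEmb π i ψ h ∘ φ (f x).2 := by
      intro x hx
      rw [← hJf x hx]; rfl
    have hlift : ∀ x, amalgamEmb π i ψ h x ∈ J →
        ∃ x', amalgamEmb π i ψ h x' = s (amalgamEmb π i ψ h x) := by
      intro x hx
      obtain ⟨w, hw⟩ := (hf _ (Finset.mem_filter.1 hx).1).2.2.1
      rw [hedge _ hx] at hw
      exact ⟨_, hw⟩
    have hyJ : y ∈ J := Finset.mem_filter.2 ⟨hy, 0, rfl⟩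
    obtain ⟨w₀, hw₀⟩ := (hf y hy).2.1
    rw [hedge y hyJ] at hw₀
    have : Nonempty X := ⟨φ (f y).2 w₀⟩
    choose! r hr using hlift
    have key := hφs (J.preimage (amalgamEmb π i ψ h) hinj.injOn) r
      (fun x => (f (amalgamEmb π i ψ h x)).2)
      ⟨φ (f y).2 w₀, by
        rw [Finset.mem_preimage]
        have hw : amalgamEmb π i ψ h (φ (f y).2 w₀) = y := hw₀
        rw [hw]; exact hyJ⟩
      (by
        intro x hx
        rw [Finset.mem_preimage] at hx
        obtain ⟨-, ⟨u, hu⟩, ⟨v, hv⟩, hne⟩ := hf _ (Finset.mem_filter.1 hx).1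
        rw [hedge _ hx] at hu hv
        refine ⟨?_, ⟨u, hinj hu⟩, ⟨v, hinj ?_⟩, ?_⟩
        · rw [Finset.mem_preimage, hr x hx]; exact hJs _ hx
        · rw [hr x hx]; exact hv
        · rw [hr x hx]
          intro heq
          exact hne (Prod.ext ((hJf _ (hJs _ hx)).trans (hJf _ hx).symm) heq))
    refine key.trans ?_
    rw [← Finset.card_image_of_injective _ hinj]
    refine Finset.card_le_card fun z hz => ?_
    obtain ⟨a, ha, rfl⟩ := Finset.mem_image.1 hz
    exact (Finset.mem_filter.1 (Finset.mem_preimage.1 ha)).1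
  -- The gain of one: `C` lies in part `i`, which every edge meets at most once, so a step inside an
  -- edge cannot stay in `C` while changing edge.
  · refine Nat.succ_le_of_lt (lt_of_le_of_lt hCg (Finset.card_lt_card ?_))
    refine ⟨fun y hy => (hC y hy).1, fun hIC => ?_⟩
    obtain ⟨x, hx⟩ := hI
    obtain ⟨hsx, ⟨u, hu⟩, ⟨v, hv⟩, hne⟩ := hf x hx
    obtain ⟨a, ha⟩ := (hC x (hIC hx)).2.1
    obtain ⟨b, hb⟩ := (hC _ (hIC hsx)).2.1
    have h1 : π (φ (f x).2 u) = i := by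
      rw [← amalgamPart_emb π i ψ (f x).1]
      change amalgamPart π i (amalgamEdge π i ψ φ (f x) u) = i
      rw [hu, ← ha]; rfl
    have h2 : π (φ (f x).2 v) = i := by
      rw [← amalgamPart_emb π i ψ (f x).1]
      change amalgamPart π i (amalgamEdge π i ψ φ (f x) v) = i
      rw [hv, ← hb]; rfl
    have huv : u = v := hφ (f x).2 (h1.trans h2.symm)
    subst huv
    exact hne (by rw [← hv, hu])

end Amalgam

/-! ### Sparse hypergraphs with monochromatic edges. -/

/-- The complete uniform hypergraph on sufficiently many vertices has a monochromatic edge. -/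
theorem exists_hasMonoEdge (K : Type) [Finite K] (W : Type) [Finite W] :
    ∃ (X E : Type) (_ : Finite X) (_ : Finite E) (φ : E → W → X),
      (∀ e, Injective (φ e)) ∧ HasMonoEdge K φ := by
  classical
  have := Fintype.ofFinite K
  have := Fintype.ofFinite W
  refine ⟨Fin (Fintype.card K * Fintype.card W + 1),
    W ↪ Fin (Fintype.card K * Fintype.card W + 1), inferInstance, inferInstance,
    fun e w => e w, fun e => e.injective, fun col => ?_⟩
  obtain ⟨c, hc⟩ := Fintype.exists_lt_card_fiber_of_mul_lt_card (f := col)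
    (n := Fintype.card W) (by simp)
  have hcard : Fintype.card W ≤ Fintype.card {x // col x = c} := by
    rw [Fintype.card_subtype]; exact hc.le
  obtain ⟨ι⟩ := Embedding.nonempty_of_card_le hcard
  exact ⟨ι.trans (Embedding.subtype _), fun w w' => (ι w).2.trans (ι w').2.symm⟩

/-- There are uniform hypergraphs of arbitrarily large girth and chromatic number. -/
theorem exists_sparse_hasMonoEdge (K : Type) [Finite K] [Nonempty K] (g : ℕ) :
    ∀ (W : Type) [Finite W], ∃ (X E : Type) (_ : Finite X) (_ : Finite E) (φ : E → W → X),
      (∀ e, Injective (φ e)) ∧ HasMonoEdge K φ ∧ Sparse g φ := by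
  classical
  induction g with
  | zero =>
    intro W _
    obtain ⟨X, E, hX, hE, φ, h1, h2⟩ := exists_hasMonoEdge K W
    exact ⟨X, E, hX, hE, φ, h1, h2, fun _ _ _ _ _ => Nat.zero_le _⟩
  | succ g ih =>
    intro W _
    obtain ⟨A, E₀, hA, hE₀, φ₀, hφ₀, hmono₀⟩ := exists_hasMonoEdge K W
    -- Partite lifts of `φ₀`: on the parts in `S`, the colour in suitably chosen lifts of edges
    -- depends on the part alone.
    have hpart : ∀ S : Finset A, ∃ (X E : Type) (_ : Finite X) (_ : Finite E) (φ : E → W → X)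
        (π : X → A), (∀ e, Injective (π ∘ φ e)) ∧ Sparse (g + 1) φ ∧
        ∀ col : X → K, ∃ col' : A → K, ∀ e₀, ∃ e, π ∘ φ e = φ₀ e₀ ∧
          ∀ w, φ₀ e₀ w ∈ S → col (φ e w) = col' (φ₀ e₀ w) := by
      intro S
      induction S using Finset.induction_on with
      | empty =>
        -- Disjoint edges: no vertex allows a change of edge.
        refine ⟨E₀ × W, E₀, inferInstance, inferInstance, fun e w => (e, w),
          fun p => φ₀ p.1 p.2, fun e => hφ₀ e, ?_, fun col => ⟨fun _ => Classical.arbitrary K,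
            fun e₀ => ⟨e₀, rfl, fun w hw => absurd hw (Finset.notMem_empty _)⟩⟩⟩
        rintro I s f ⟨x, hx⟩ hf
        obtain ⟨hsx, -, ⟨v, hv⟩, hne⟩ := hf x hx
        obtain ⟨-, ⟨u, hu⟩, -, -⟩ := hf _ hsx
        exact absurd (congrArg Prod.fst (hu.trans hv.symm)) hne
      | insert i S _ ihS =>
        obtain ⟨X, E, hX, hE, φ, π, hφ, hφs, hcol⟩ := ihS
        -- Hyperedges are indexed by all of `X`, though only part `i` is glued; a monochromatic one
        -- makes part `i` of its copy monochromatic.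
        obtain ⟨XH, EH, hXH, hEH, ψ, hψi, hψm, hψs⟩ := ih X
        refine ⟨XH ⊕ EH × X, EH × E, inferInstance, inferInstance, amalgamEdge π i ψ φ,
          amalgamPart π i, fun p => ?_, sparse_amalgamEdge hφ hφs hψi hψs, fun col => ?_⟩
        · have : amalgamPart π i ∘ amalgamEdge π i ψ φ p = π ∘ φ p.2 :=
            funext fun w => amalgamPart_emb π i ψ p.1 (φ p.2 w)
          rw [this]; exact hφ p.2
        · obtain ⟨h, hh⟩ := hψm fun a => col (Sum.inl a)
          obtain ⟨col', hcol'⟩ := hcol fun x => col (amalgamEmb π i ψ h x)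
          have hc : ∃ c, ∀ x, π x = i → col (amalgamEmb π i ψ h x) = c := by
            by_cases hne : Nonempty X
            · obtain ⟨x₀⟩ := hne
              refine ⟨col (Sum.inl (ψ h x₀)), fun x hx => ?_⟩
              rw [amalgamEmb, if_pos hx]
              exact hh x x₀
            · exact ⟨Classical.arbitrary K, fun x => absurd ⟨x⟩ hne⟩
          obtain ⟨c, hc⟩ := hc
          refine ⟨update col' i c, fun e₀ => ?_⟩
          obtain ⟨e, he, hew⟩ := hcol' e₀
          refine ⟨(h, e), ?_, fun w hw => ?_⟩
          · rw [← he]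
            exact funext fun w => amalgamPart_emb π i ψ h (φ e w)
          · by_cases hi : φ₀ e₀ w = i
            · rw [hi, update_self]
              exact hc _ ((congrFun he w).trans hi)
            · rw [update_of_ne hi]
              exact hew w (Finset.mem_of_mem_insert_of_ne hw hi)
    have := Fintype.ofFinite A
    obtain ⟨X, E, hX, hE, φ, π, hφ, hφs, hcol⟩ := hpart Finset.univ
    refine ⟨X, E, hX, hE, φ, fun e => (hφ e).of_comp, fun col => ?_, hφs⟩
    obtain ⟨col', hcol'⟩ := hcol col
    obtain ⟨e₀, he₀⟩ := hmono₀ col'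
    obtain ⟨e, -, he⟩ := hcol' e₀
    refine ⟨e, fun w w' => ?_⟩
    rw [he w (Finset.mem_univ _), he w' (Finset.mem_univ _)]
    exact he₀ w w'

/-! ### Tutte's construction for digraphs. -/

/-- Every nonempty finite set that is closed under a non-backtracking successor map along the arcs
of `D` has at least `g` vertices at which the direction changes. -/
def ManyChanges {V : Type} (g : ℕ) (D : V → V → Prop) : Prop :=
  ∀ (I : Finset V) (s : V → V), I.Nonempty →
    (∀ x ∈ I, s x ∈ I ∧ (D x (s x) ∨ D (s x) x) ∧ s (s x) ≠ x) →
    ∃ C : Finset V, g ≤ C.card ∧ ∀ y ∈ C, ∃ z ∈ I, s z = y ∧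
      (D z y ∧ D (s y) y ∨ D y z ∧ D y (s y))

section Tutte

variable {V XH EH : Type} (D : V → V → Prop) (ψ : EH → V → XH)

/-- The arcs of the copy of `D` indexed by `h`, together with the arcs that match it with the
hyperedge `ψ h`. -/
inductive TutteArc (h : EH) : XH ⊕ EH × V → XH ⊕ EH × V → Prop
  | copy {u v : V} : D u v → TutteArc h (Sum.inr (h, u)) (Sum.inr (h, v))
  | matching (u : V) : TutteArc h (Sum.inr (h, u)) (Sum.inl (ψ h u))

variable {D ψ}

/-- Label each step by its hyperedge. A constant label confines the orbit to a copy of `D`;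
otherwise the label changes at g or more hypergraph vertices, which are sinks. -/
theorem manyChanges_tutteArc {g : ℕ} (hD : ManyChanges g D) (hψi : ∀ h, Injective (ψ h))
    (hψ : Sparse g ψ) : ManyChanges g fun p q => ∃ h, TutteArc D ψ h p q := by
  classical
  intro I s hI hf
  have hs : ∀ x ∈ I, s x ∈ I := fun x hx => (hf x hx).1
  have hlab : ∀ x ∈ I, ∃ h, TutteArc D ψ h x (s x) ∨ TutteArc D ψ h (s x) x := by
    intro x hx
    rcases (hf x hx).2.1 with ⟨h, hh⟩ | ⟨h, hh⟩
    · exact ⟨h, Or.inl hh⟩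
    · exact ⟨h, Or.inr hh⟩
  have : Nonempty EH := by
    obtain ⟨x, hx⟩ := hI
    exact ⟨(hlab x hx).choose⟩
  choose! κ hκ using hlab
  rcases constant_label_or_many_changes hψ Sum.inl Sum.inl_injective
      (fun h => {p | (∃ v, p = Sum.inr (h, v)) ∨ ∃ v, p = Sum.inl (ψ h v)})
      (by
        rintro h h' x hne (⟨u, rfl⟩ | ⟨u, rfl⟩) (⟨v, hv⟩ | ⟨v, hv⟩)
        · exact absurd (Prod.mk.inj (Sum.inr.inj hv)).1 hne
        · cases hv
        · cases hv
        · exact ⟨_, rfl⟩)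
      (by
        rintro h a (⟨u, hu⟩ | ⟨u, hu⟩)
        · cases hu
        · exact ⟨u, (Sum.inl.inj hu).symm⟩)
      I hI s κ hs
      (by
        intro x hx
        have harc : ∀ {h p q}, TutteArc D ψ h p q →
            (∃ v, p = Sum.inr (h, v)) ∧
              ((∃ v, q = Sum.inr (h, v)) ∨ ∃ v, q = Sum.inl (ψ h v)) := by
          rintro h p q (⟨_⟩ | _)
          · exact ⟨⟨_, rfl⟩, Or.inl ⟨_, rfl⟩⟩
          · exact ⟨⟨_, rfl⟩, Or.inr ⟨_, rfl⟩⟩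
        rcases hκ x hx with hh | hh
        · exact ⟨Or.inl (harc hh).1, (harc hh).2⟩
        · exact ⟨(harc hh).2, Or.inl (harc hh).1⟩) with ⟨y, hy, hconst⟩ | ⟨C, hCg, hC⟩
  · set h := κ y with hh
    -- Within label `h` a hypergraph vertex has only one neighbour, so passing through it would
    -- backtrack. The start `y` may itself be such a vertex, hence `k + 1`.
    have hcopy : ∀ k, ∃ v, s^[k + 1] y = Sum.inr (h, v) := by
      intro k
      have hk := iterate_mem hs hy k
      have h1 := hκ _ hk
      have h2 := hκ _ (hs _ hk)
      have hne := (hf _ hk).2.2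
      have hl := hconst (k + 1)
      rw [iterate_succ_apply'] at hl
      rw [hconst k] at h1
      rw [hl] at h2
      rw [iterate_succ_apply']
      generalize s^[k] y = p at *
      generalize s p = q at *
      generalize s q = r at *
      cases q with
      | inr q =>
        rcases h1 with h1 | h1 <;> cases h1 <;> exact ⟨_, rfl⟩
      | inl a =>
        exfalso
        rcases h1 with h1 | h1
        · cases h1 with
          | matching u =>
            rcases h2 with h2 | h2
            · cases h2
            · generalize hb : ψ h u = b at h2
              cases h2 with
              | matching u' => exact hne (by rw [hψi h hb])
        · cases h1
    let J := I.filter fun x => ∃ k, s^[k + 1] y = x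
    have hJs : ∀ x ∈ J, s x ∈ J := by
      intro x hx
      obtain ⟨hxI, k, rfl⟩ := Finset.mem_filter.1 hx
      exact Finset.mem_filter.2 ⟨hs _ hxI, k + 1, iterate_succ_apply' _ _ _⟩
    have hJκ : ∀ x ∈ J, κ x = h := by
      intro x hx
      obtain ⟨-, k, rfl⟩ := Finset.mem_filter.1 hx
      exact hconst (k + 1)
    have hJc : ∀ x ∈ J, ∃ v, Sum.inr (h, v) = x := by
      intro x hx
      obtain ⟨-, k, rfl⟩ := Finset.mem_filter.1 hx
      obtain ⟨v, hv⟩ := hcopy k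
      exact ⟨v, hv.symm⟩
    have hyJ : s y ∈ J := Finset.mem_filter.2 ⟨hs _ hy, 0, rfl⟩
    obtain ⟨v₀, hv₀⟩ := hJc _ hyJ
    have : Nonempty V := ⟨v₀⟩
    have hinj : Injective fun v : V => (Sum.inr (h, v) : XH ⊕ EH × V) :=
      fun u v huv => (Prod.mk.inj (Sum.inr.inj huv)).2
    have hlift : ∀ v, Sum.inr (h, v) ∈ J →
        ∃ v', (Sum.inr (h, v') : XH ⊕ EH × V) = s (Sum.inr (h, v)) :=
      fun v hv => hJc _ (hJs _ hv)
    choose! r hr using hlift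
    have hrJ : ∀ v, Sum.inr (h, v) ∈ J → Sum.inr (h, r v) ∈ J := by
      intro v hv
      rw [hr v hv]; exact hJs _ hv
    have hback : ∀ {u v}, TutteArc D ψ h (Sum.inr (h, u)) (Sum.inr (h, v)) → D u v := by
      intro u v huv
      cases huv with
      | copy huv => exact huv
    obtain ⟨C, hCg, hC⟩ := hD (J.preimage _ hinj.injOn) r
      ⟨v₀, by rw [Finset.mem_preimage, hv₀]; exact hyJ⟩
      (by
        intro v hv
        rw [Finset.mem_preimage] at hv
        have hvI := (Finset.mem_filter.1 hv).1
        refine ⟨Finset.mem_preimage.2 (hrJ v hv), ?_, fun heq => (hf _ hvI).2.2 ?_⟩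
        · have hk := hκ _ hvI
          rw [hJκ _ hv, ← hr v hv] at hk
          exact hk.imp hback hback
        · rw [← hr v hv, ← hr _ (hrJ v hv), heq])
    refine ⟨C.image fun v => Sum.inr (h, v), ?_, fun y hy => ?_⟩
    · rwa [Finset.card_image_of_injective _ hinj]
    · obtain ⟨v, hv, rfl⟩ := Finset.mem_image.1 hy
      obtain ⟨z, hz, rfl, hzv⟩ := hC v hv
      rw [Finset.mem_preimage] at hz
      refine ⟨Sum.inr (h, z), (Finset.mem_filter.1 hz).1, (hr z hz).symm, ?_⟩
      rw [← hr _ (hrJ z hz)]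
      exact hzv.imp (fun hd => ⟨⟨h, .copy hd.1⟩, ⟨h, .copy hd.2⟩⟩)
        (fun hd => ⟨⟨h, .copy hd.1⟩, ⟨h, .copy hd.2⟩⟩)
  · refine ⟨C, hCg, fun y hy => ?_⟩
    obtain ⟨hyI, ⟨a, rfl⟩, z, hz, hzy, -⟩ := hC y hy
    refine ⟨z, hz, hzy, Or.inl ⟨⟨κ z, ?_⟩, ⟨κ (Sum.inl a), ?_⟩⟩⟩
    · have h1 := hκ z hz
      rw [hzy] at h1
      rcases h1 with h1 | h1
      · exact h1
      · cases h1
    · rcases hκ _ hyI with h1 | h1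
      · generalize s (Sum.inl a) = q at h1
        cases h1
      · exact h1

end Tutte

/-- Asymmetric relations of every chromatic number in which all cycles change direction often. -/
theorem exists_manyChanges (g n : ℕ) :
    ∃ (V : Type) (_ : Finite V) (D : V → V → Prop), (∀ u v, D u v → ¬ D v u) ∧
      (∃ col : V → Fin (n + 1), ∀ u v, D u v → col u ≠ col v) ∧
      (¬ ∃ col : V → Fin n, ∀ u v, D u v → col u ≠ col v) ∧ ManyChanges g D := by
  induction n with
  | zero =>
    refine ⟨Unit, inferInstance, fun _ _ => False, fun _ _ h => h.elim,
      ⟨fun _ => 0, fun _ _ h => h.elim⟩, fun ⟨col, _⟩ => (col ()).elim0, ?_⟩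
    rintro I s ⟨x, hx⟩ hI
    exact ((hI x hx).2.1.elim id id).elim
  | succ n ih =>
    obtain ⟨V, hV, D, hasymm, ⟨col, hcol⟩, hncol, hD⟩ := ih
    obtain ⟨XH, EH, hXH, hEH, ψ, hψi, hψm, hψs⟩ :=
      exists_sparse_hasMonoEdge (Fin (n + 1)) g V
    refine ⟨XH ⊕ EH × V, inferInstance, fun p q => ∃ h, TutteArc D ψ h p q, ?_, ?_, ?_,
      manyChanges_tutteArc hD hψi hψs⟩
    · rintro _ _ ⟨h, huv | u⟩ ⟨h', hvu⟩
      · cases hvu with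
        | copy hvu => exact hasymm _ _ huv hvu
      · cases hvu
    -- All hypergraph vertices share the new colour, as no arc joins two of them.
    · refine ⟨Sum.elim (fun _ => Fin.last _) fun p => (col p.2).castSucc, ?_⟩
      rintro _ _ ⟨h, huv | u⟩
      · exact fun heq => hcol _ _ huv (Fin.castSucc_injective _ heq)
      · exact Fin.castSucc_ne_last _
    · rintro ⟨col', hcol'⟩
      obtain ⟨h, hh⟩ := hψm fun a => col' (Sum.inl a)
      by_cases hne : Nonempty V
      · obtain ⟨v₀⟩ := hne
        -- The copy matched with a monochromatic hyperedge misses that colour.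
        have hmiss : ∀ v, col' (Sum.inr (h, v)) ≠ col' (Sum.inl (ψ h v₀)) := by
          intro v heq
          exact hcol' _ _ ⟨h, .matching v⟩ (heq.trans (hh v₀ v))
        choose c hc using fun v => Fin.exists_succAbove_eq (hmiss v)
        refine hncol ⟨c, fun u v huv heq => hcol' _ _ ⟨h, .copy huv⟩ ?_⟩
        rw [← hc u, ← hc v, heq]
      · exact hncol ⟨fun v => absurd ⟨v⟩ hne, fun v => absurd ⟨v⟩ hne⟩

/-! ### From graph cycles to successor maps. -/

/-- The vertices of a cycle carry a non-backtracking successor map along its edges. -/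
theorem exists_successor_of_isCycle {V : Type} {G : SimpleGraph V} {v : V} {c : G.Walk v v}
    (hc : c.IsCycle) :
    ∃ (I : Finset V) (s : V → V), I.Nonempty ∧
      ∀ x ∈ I, s x ∈ I ∧ s(x, s x) ∈ c.edges ∧ s (s x) ≠ x := by
  classical
  have hlen := hc.three_le_length
  have hinj := hc.getVert_injOn'
  have hex : ∀ x ∈ (Finset.range c.length).image c.getVert,
      ∃ i, i < c.length ∧ c.getVert i = x := by
    intro x hx
    obtain ⟨i, hi, rfl⟩ := Finset.mem_image.1 hx
    exact ⟨i, Finset.mem_range.1 hi, rfl⟩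
  choose! idx hidx hget using hex
  have hmem : ∀ i, i < c.length → c.getVert i ∈ (Finset.range c.length).image c.getVert :=
    fun i hi => Finset.mem_image_of_mem _ (Finset.mem_range.2 hi)
  have hidx_get : ∀ i, i < c.length → idx (c.getVert i) = i := by
    intro i hi
    have h1 := hidx _ (hmem i hi)
    exact hinj (by simp only [Set.mem_ofPred_eq]; omega) (by simp only [Set.mem_ofPred_eq]; omega)
      (hget _ (hmem i hi))
  have hlast : c.getVert c.length = c.getVert 0 := by simp
  refine ⟨(Finset.range c.length).image c.getVert, fun x => c.getVert (idx x + 1),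
    ⟨_, hmem 0 (by omega)⟩, fun x hx => ?_⟩
  obtain ⟨i, hi, rfl⟩ := Finset.mem_image.1 hx
  rw [Finset.mem_range] at hi
  dsimp only
  rw [hidx_get i hi]
  refine ⟨?_, ?_, ?_⟩
  · by_cases h1 : i + 1 < c.length
    · exact hmem _ h1
    · rw [show i + 1 = c.length by omega, hlast]; exact hmem _ (by omega)
  · exact c.mk_mem_edges_iff_exists.2 ⟨i, hi, rfl⟩
  · have hne : ∀ a b, a < c.length → b < c.length → a ≠ b → c.getVert a ≠ c.getVert b := by
      intro a b ha hb hab heq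
      exact hab (by rw [← hidx_get a ha, heq, hidx_get b hb])
    by_cases h1 : i + 1 < c.length
    · rw [hidx_get _ h1]
      by_cases h2 : i + 1 + 1 < c.length
      · exact hne _ _ h2 hi (by omega)
      · rw [show i + 1 + 1 = c.length by omega, hlast]
        exact hne _ _ (by omega) hi (by omega)
    · rw [show i + 1 = c.length by omega, hlast, hidx_get 0 (by omega)]
      exact hne _ _ (by omega) hi (by omega)

/-- Distinct vertices at which the direction changes give distinct changes of direction. -/
theorem le_ncard_changesOfDirection {V : Type} [Finite V] {g : ℕ} (D : Digraph V)
    (C : Finset V) (hCg : g ≤ C.card)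
    (hC : ∀ y ∈ C, ∃ z w, z ≠ w ∧ (D.Adj z y ∧ D.Adj w y ∨ D.Adj y z ∧ D.Adj y w)) :
    g ≤ (changesOfDirection D).ncard := by
  have hpair : ∀ y ∈ C, ∃ p ∈ changesOfDirection D, ∃ z w, z ≠ w ∧
      (p = s((z, y), (w, y)) ∨ p = s((y, z), (y, w))) := by
    intro y hy
    obtain ⟨z, w, hzw, h | h⟩ := hC y hy
    · exact ⟨_, ⟨z, y, w, hzw, Or.inl ⟨h.1, h.2, rfl⟩⟩, z, w, hzw, Or.inl rfl⟩
    · exact ⟨_, ⟨z, y, w, hzw, Or.inr ⟨h.1, h.2, rfl⟩⟩, z, w, hzw, Or.inr rfl⟩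
  rcases C.eq_empty_or_nonempty with rfl | ⟨y₀, -⟩
  · exact hCg.trans (Nat.zero_le _)
  have : Nonempty V := ⟨y₀⟩
  have : Nonempty (Sym2 (V × V)) := ⟨s((y₀, y₀), (y₀, y₀))⟩
  choose! p hp z w hzw hpe using hpair
  -- As `z ≠ w`, the pair of arcs determines their common head or tail, and cannot have both.
  have hinj : Set.InjOn p (C : Set V) := by
    intro a ha b hb hab
    have h1 := hzw a ha
    have h2 := hzw b hb
    rcases hpe a ha with h3 | h3 <;> rcases hpe b hb with h4 | h4 <;>
      · rw [h3, h4, Sym2.eq_iff] at hab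
        simp only [Prod.mk.injEq] at hab
        grind
  calc g ≤ C.card := hCg
    _ = (p '' (C : Set V)).ncard := by rw [hinj.ncard_image, Set.ncard_coe_finset]
    _ ≤ _ := Set.ncard_le_ncard (by rintro _ ⟨y, hy, rfl⟩; exact hp y hy) (Set.toFinite _)

end OrientedGraph

theorem lemma2p2 (g n : ℕ) (hg : 3 ≤ g) (hn : 2 ≤ n) :
    ∃ (V : Type) (_ : Finite V) (Y : SimpleGraph V) (D : Digraph V),
      OrientedGraph.IsOrientation D Y ∧
      Y.chromaticNumber = (n : ℕ∞) ∧
      ∀ (v : V) (c : Y.Walk v v), c.IsCycle →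
        g ≤ (OrientedGraph.changesOfDirection (OrientedGraph.orientedWalk D c)).ncard := by
  obtain ⟨m, rfl⟩ : ∃ m, n = m + 1 := ⟨n - 1, by omega⟩
  obtain ⟨V, hV, D, hasymm, ⟨col, hcol⟩, hncol, hD⟩ := OrientedGraph.exists_manyChanges g m
  have hirr : ∀ u, ¬ D u u := fun u h => hasymm u u h h
  let Y : SimpleGraph V :=
    { Adj := fun u v => D u v ∨ D v u
      symm := ⟨fun _ _ h => h.symm⟩
      loopless := ⟨fun u h => h.elim (hirr u) (hirr u)⟩ }
  refine ⟨V, hV, Y, ⟨D⟩, ⟨fun _ _ => Iff.rfl, hasymm⟩, ?_, ?_⟩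
  · have h1 : Y.Colorable (m + 1) :=
      ⟨SimpleGraph.Coloring.mk col fun {u v} h =>
        h.elim (hcol u v) fun h => (hcol v u h).symm⟩
    have h2 : ¬ Y.Colorable m := by
      rintro ⟨c⟩
      exact hncol ⟨c, fun u v h => c.valid (Or.inl h)⟩
    refine le_antisymm h1.chromaticNumber_le ?_
    by_contra hlt
    rw [not_le] at hlt
    refine h2 (SimpleGraph.chromaticNumber_le_iff_colorable.1 ?_)
    exact Order.le_of_lt_add_one (by exact_mod_cast hlt)
  · intro v c hc
    obtain ⟨I, s, hI, hs⟩ := OrientedGraph.exists_successor_of_isCycle hc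
    obtain ⟨C, hCg, hC⟩ := hD I s hI fun x hx =>
      ⟨(hs x hx).1, c.adj_of_mem_edges (hs x hx).2.1, (hs x hx).2.2⟩
    refine OrientedGraph.le_ncard_changesOfDirection _ C hCg fun y hy => ?_
    obtain ⟨z, hz, rfl, hzy⟩ := hC y hy
    have h1 := (hs z hz).2.1
    have h2 := (hs _ (hs z hz).1).2.1
    refine ⟨z, s (s z), (hs z hz).2.2.symm, hzy.imp (fun h => ⟨⟨h.1, h1⟩, ⟨h.2, ?_⟩⟩)
      fun h => ⟨⟨h.1, ?_⟩, ⟨h.2, h2⟩⟩⟩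
    · rwa [Sym2.eq_swap]
    · rwa [Sym2.eq_swap]
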